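/- Let $m,n\ge 1$ be coprime integers and let $\mathbb F$ be an algebraically closed field of characteristic $p\ge 0$. Let $\Gamma=\langle a,b\mid a^m=b^n\rangle$ be the group of the torus knot $T(m,n)$. The character of a representation $\rho\colon\Gamma\to \mathrm{SL}_2(\mathbb F)$ is the function $\chi_\rho(\gamma)=\operatorname{tr}\rho(\gamma)$. Let $X(T(m,n))\subset\mathbb F^3$ be the set of all points $(x,y,z)=(\chi_\rho(a),\chi_\rho(b),\chi_\rho(ab^{-1}))$ with $\rho\colon\Gamma\to\mathrm{SL}_2(\mathbb F)$ a representation, and let $X^{ab}(T(m,n))$ be the subset of those points that come from representations $\rho$ with abelian image. Two curves in $\mathbb F^3$ are said to meet transversally (respectively tangentially) at a common point $P$ if both are smooth at $P$ and their tangent lines at $P$ are distinct (respectively equal). Then: 1. $X^{ab}(T(m,n))$ is an irreducible component of $X(T(m,n))$ (for the Zariski topology of $\mathbb F^3$). If $p=0$, or if $p$ is coprime to $mn$, then for each other irreducible component $Z$ of $X(T(m,n))$ the intersection $X^{ab}(T(m,n))\cap Z$ consists of exactly two distinct points, and it is transverse at both of them. 2. If $p$ is prime and $p\mid n$, then for each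 irreducible component $Z$ of $X(T(m,n))$ that is contained in one of the planes $y=2$, $y=-2$, the intersection $X^{ab}(T(m,n))\cap Z$ consists of a single point, and at that point $X^{ab}(T(m,n))$ and $Z$ meet tangentially. -/

import Mathlib

namespace TorusKnot

/-- The group `⟨a, b ∣ a ^ m = b ^ n⟩`, i.e. the fundamental group of the exterior of the
torus knot `T(m, n)`. -/
abbrev KnotGroup (m n : ℕ) : Type :=
  PresentedGroup
    ({FreeGroup.of 0 ^ m * (FreeGroup.of 1 ^ n)⁻¹} : Set (FreeGroup (Fin 2)))

/-- The first generator `a` of `⟨a, b ∣ a ^ m = b ^ n⟩`. -/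
def genA (m n : ℕ) : KnotGroup m n := PresentedGroup.of 0

/-- The second generator `b` of `⟨a, b ∣ a ^ m = b ^ n⟩`. -/
def genB (m n : ℕ) : KnotGroup m n := PresentedGroup.of 1

section Characters

variable {Γ : Type*} [Group Γ] {F : Type*} [Field F]

/-- The character `γ ↦ tr ρ(γ)` of a representation `ρ : Γ → SL₂(F)`. -/
def character (ρ : Γ →* Matrix.SpecialLinearGroup (Fin 2) F) (g : Γ) : F :=
  (ρ g).val.trace

variable (Γ F)

/-- The set of all characters of representations of `Γ` into `SL₂(F)`. -/
def characters : Set (Γ → F) :=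
  {χ | ∃ ρ : Γ →* Matrix.SpecialLinearGroup (Fin 2) F, χ = character ρ}

/-- The set of characters of abelian representations, i.e. those with commutative image. -/
def abelianCharacters : Set (Γ → F) :=
  {χ | ∃ ρ : Γ →* Matrix.SpecialLinearGroup (Fin 2) F,
    (∀ g h : Γ, Commute (ρ g) (ρ h)) ∧ χ = character ρ}

end Characters

section CharacterVariety

variable (m n : ℕ) (F : Type*) [Field F]

/-- The coordinates `(x, y, z) = (χ(a), χ(b), χ(a b⁻¹))` of a character `χ`. -/
def coords (χ : KnotGroup m n → F) : Fin 3 → F :=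
  ![χ (genA m n), χ (genB m n), χ (genA m n * (genB m n)⁻¹)]

/-- The character variety `X(T(m, n))` over `F`, in the coordinates `(x, y, z)`. -/
def X : Set (Fin 3 → F) := coords m n F '' characters (KnotGroup m n) F

/-- The set `X^ab(T(m, n))` of abelian characters, in the coordinates `(x, y, z)`. -/
def Xab : Set (Fin 3 → F) := coords m n F '' abelianCharacters (KnotGroup m n) F

end CharacterVariety

section AlgebraicGeometry

variable {F : Type*} [Field F]

/-- `Z` is an irreducible Zariski-closed subset of affine 3-space (in particular, nonempty):
it is cut out by polynomials and its vanishing ideal is prime. -/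
def IsIrreducibleClosed (Z : Set (Fin 3 → F)) : Prop :=
  (∃ I : Ideal (MvPolynomial (Fin 3) F), Z = MvPolynomial.zeroLocus F I) ∧
    (MvPolynomial.vanishingIdeal F Z).IsPrime

/-- `Z` is an irreducible component of `V`: a maximal irreducible Zariski-closed subset
of affine 3-space contained in `V`. -/
def IsComponent (V Z : Set (Fin 3 → F)) : Prop :=
  Maximal (fun W : Set (Fin 3 → F) => W ⊆ V ∧ IsIrreducibleClosed W) Z

/-- The Zariski tangent space at `P` of an algebraic set `Z` (with its reduced structure):
the common kernel of the differentials at `P` of all polynomials vanishing on `Z`. -/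
def tangentSpace (Z : Set (Fin 3 → F)) (P : Fin 3 → F) : Submodule F (Fin 3 → F) where
  carrier := {v | ∀ f ∈ MvPolynomial.vanishingIdeal F Z,
    ∑ i, MvPolynomial.eval P (MvPolynomial.pderiv i f) * v i = 0}
  zero_mem' f _ := by simp
  add_mem' {v w} hv hw f hf := by
    simp only [Pi.add_apply, mul_add, Finset.sum_add_distrib, hv f hf, hw f hf, add_zero]
  smul_mem' c v hv f hf := by
    have h := congrArg (fun t => c * t) (hv f hf)
    simp only [Finset.mul_sum, mul_zero] at h
    rw [← h]
    refine Finset.sum_congr rfl fun i _ => ?_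
    simp only [Pi.smul_apply, smul_eq_mul]
    ring

/-- The curves `Z` and `W` intersect transversally at `P`: `P` lies on both, both are smooth
at `P` (the tangent spaces are lines), and the two tangent lines are distinct. -/
def IsTransverseAt (Z W : Set (Fin 3 → F)) (P : Fin 3 → F) : Prop :=
  P ∈ Z ∧ P ∈ W ∧
    Module.finrank F (tangentSpace Z P) = 1 ∧ Module.finrank F (tangentSpace W P) = 1 ∧
    tangentSpace Z P ≠ tangentSpace W P

/-- The curves `Z` and `W` intersect tangentially at `P`: `P` lies on both, both are smooth
at `P` (the tangent spaces are lines), and the two tangent lines coincide. -/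
def IsTangentAt (Z W : Set (Fin 3 → F)) (P : Fin 3 → F) : Prop :=
  P ∈ Z ∧ P ∈ W ∧
    Module.finrank F (tangentSpace Z P) = 1 ∧ Module.finrank F (tangentSpace W P) = 1 ∧
    tangentSpace Z P = tangentSpace W P

end AlgebraicGeometry

end TorusKnot

/-! A commuting pair has a common eigenvector with eigenvalues a, b satisfying a^m = b^n, and
coprimality writes a = t^n, b = t^m. Hence X^ab is the polynomial curve s ↦ (C_n(s), C_m(s),
C_{n-m}(s)), where s = t + t⁻¹ and C_k(t + t⁻¹) = t^k + t⁻ᵏ. Bézout also makes s a polynomial in the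
three coordinates (`exists_aeval_abParam`), so this is a closed embedded line: irreducible, smooth,
with tangent spanned by the velocity (`tangentSpace_curve`).

If A and B do not commute, A^m = B^n commutes with both. As A^m = S_{m-1}(tr A) A - S_{m-2}(tr A),
this forces S_{m-1}(tr A) = 0, and likewise S_{n-1}(tr B) = 0. Only finitely many (x, y) arise
(`lineBase`), and the whole vertical line above each lies in X. So the components are X^ab and these
lines.

The line above (a + a⁻¹, b + b⁻¹) meets X^ab where t^n = a and t^m = b or b⁻¹, up to inverting t.
These two points coincide when b = b⁻¹, that is y = ±2. Since C_k' = k S_{k-1}, the velocity of X^ab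
starts with (n S_{n-1}(s), m S_{m-1}(s)), and the curves are tangent exactly when both entries
vanish. The identity S_{k-1}(t + t⁻¹)(t - t⁻¹) = t^k - t⁻ᵏ decides this. -/

namespace TorusKnot

/-! ### Polynomial curves with a polynomial left inverse: ideals and tangents -/

section Curves

variable {F : Type*} [Field F]

/-- The image of the polynomial map `s ↦ (φ₀(s), φ₁(s), φ₂(s))`. -/
def curve (φ : Fin 3 → Polynomial F) : Set (Fin 3 → F) :=
  Set.range fun s i => (φ i).eval s

lemma eval_aeval_curve (φ : Fin 3 → Polynomial F) (f : MvPolynomial (Fin 3) F) (s : F) :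
    (MvPolynomial.aeval φ f).eval s = MvPolynomial.eval (fun i => (φ i).eval s) f := by
  induction f using MvPolynomial.induction_on with
  | C a => simp
  | add p q hp hq => simp [hp, hq]
  | mul_X p i hp => simp [hp]

lemma eval_polynomial_aeval (q : Polynomial F) (σ : MvPolynomial (Fin 3) F) (P : Fin 3 → F) :
    MvPolynomial.eval P (Polynomial.aeval σ q) = q.eval (MvPolynomial.eval P σ) := by
  rw [Polynomial.aeval_def, Polynomial.hom_eval₂, ← Polynomial.eval₂_id]
  congr 1
  ext a
  simp

lemma vanishingIdeal_curve [Infinite F] (φ : Fin 3 → Polynomial F) :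
    MvPolynomial.vanishingIdeal F (curve φ) =
      RingHom.ker (MvPolynomial.aeval φ : MvPolynomial (Fin 3) F →ₐ[F] Polynomial F) := by
  ext f
  rw [MvPolynomial.mem_vanishingIdeal_iff, RingHom.mem_ker]
  constructor
  · intro h
    refine Polynomial.funext fun s => ?_
    rw [eval_aeval_curve, Polynomial.eval_zero]
    simpa [MvPolynomial.aeval_eq_eval] using h _ ⟨s, rfl⟩
  · rintro h _ ⟨s, rfl⟩
    have := eval_aeval_curve φ f s
    rw [h, Polynomial.eval_zero] at this
    simpa [MvPolynomial.aeval_eq_eval] using this.symm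

variable {φ : Fin 3 → Polynomial F} {σ : MvPolynomial (Fin 3) F}

lemma X_sub_aeval_mem_vanishingIdeal [Infinite F]
    (hσ : MvPolynomial.aeval φ σ = Polynomial.X) (i : Fin 3) :
    MvPolynomial.X i - Polynomial.aeval σ (φ i) ∈ MvPolynomial.vanishingIdeal F (curve φ) := by
  rw [vanishingIdeal_curve, RingHom.mem_ker, map_sub, ← Polynomial.aeval_algHom_apply, hσ]
  simp

/-- The left inverse σ recovers the parameter: a point satisfying the equations x_i = φ_i(σ) is the
point of parameter σ(P). Primality holds because the ideal is the kernel of a map to a domain. -/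
lemma isIrreducibleClosed_curve [Infinite F] (hσ : MvPolynomial.aeval φ σ = Polynomial.X) :
    IsIrreducibleClosed (curve φ) := by
  refine ⟨⟨MvPolynomial.vanishingIdeal F (curve φ), ?_⟩, ?_⟩
  · refine le_antisymm (MvPolynomial.zeroLocus_vanishingIdeal_le _) fun P hP => ?_
    refine ⟨MvPolynomial.eval P σ, funext fun i => ?_⟩
    have h := hP _ (X_sub_aeval_mem_vanishingIdeal hσ i)
    rw [MvPolynomial.aeval_eq_eval, map_sub, MvPolynomial.eval_X, sub_eq_zero,
      eval_polynomial_aeval] at h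
    exact h.symm
  · rw [vanishingIdeal_curve]
    exact RingHom.ker_isPrime _

lemma derivative_aeval_curve (φ : Fin 3 → Polynomial F) (f : MvPolynomial (Fin 3) F) :
    Polynomial.derivative (MvPolynomial.aeval φ f) =
      ∑ i, MvPolynomial.aeval φ (MvPolynomial.pderiv i f) * Polynomial.derivative (φ i) := by
  induction f using MvPolynomial.induction_on with
  | C a => simp
  | add p q hp hq => simp [hp, hq, add_mul, Finset.sum_add_distrib]
  | mul_X p i hp =>
    have h (j : Fin 3) : MvPolynomial.aeval φ (MvPolynomial.pderiv j (p * MvPolynomial.X i)) *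
        Polynomial.derivative (φ j) =
          MvPolynomial.aeval φ (MvPolynomial.pderiv j p) * Polynomial.derivative (φ j) * φ i +
          if i = j then MvPolynomial.aeval φ p * Polynomial.derivative (φ j) else 0 := by
      rw [Derivation.leibniz, MvPolynomial.pderiv_X, Pi.single_apply, smul_eq_mul, smul_eq_mul,
        map_add, map_mul, map_mul, MvPolynomial.aeval_X]
      split_ifs
      · rw [map_one]
        ring
      · rw [map_zero]
        ring
    rw [Finset.sum_congr rfl fun j _ => h j, Finset.sum_add_distrib, Finset.sum_ite_eq,
      if_pos (Finset.mem_univ i), ← Finset.sum_mul, ← hp, map_mul, MvPolynomial.aeval_X,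
      Polynomial.derivative_mul]

/-- The velocity vector of a polynomial curve. -/
noncomputable def velocity (φ : Fin 3 → Polynomial F) (s : F) : Fin 3 → F :=
  fun i => (Polynomial.derivative (φ i)).eval s

/-- Differentiating the equations x_i = φ_i(σ) shows that a tangent vector v equals dσ(v) times the
velocity; the chain rule gives the converse. -/
lemma tangentSpace_curve [Infinite F] (hσ : MvPolynomial.aeval φ σ = Polynomial.X) (s : F) :
    tangentSpace (curve φ) (fun i => (φ i).eval s) = Submodule.span F {velocity φ s} := by
  have hs : MvPolynomial.eval (fun i => (φ i).eval s) σ = s := by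
    rw [← eval_aeval_curve, hσ, Polynomial.eval_X]
  apply le_antisymm
  · intro v hv
    rw [Submodule.mem_span_singleton]
    refine ⟨∑ j, MvPolynomial.eval (fun i => (φ i).eval s) (MvPolynomial.pderiv j σ) * v j,
      funext fun i => ?_⟩
    have h := hv _ (X_sub_aeval_mem_vanishingIdeal hσ i)
    have key : MvPolynomial.eval (fun i => (φ i).eval s)
        (Polynomial.aeval σ (Polynomial.derivative (φ i))) = velocity φ s i := by
      rw [eval_polynomial_aeval, hs, velocity]
    simp only [map_sub, Derivation.map_aeval, smul_eq_mul, map_mul, key, sub_mul,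
      Finset.sum_sub_distrib, MvPolynomial.pderiv_X] at h
    rw [Finset.sum_eq_single i (fun j _ hj => by simp [Pi.single_eq_of_ne hj.symm]) (by simp)] at h
    simp only [Pi.single_eq_same, map_one, one_mul, sub_eq_zero] at h
    rw [h, Pi.smul_apply, smul_eq_mul, Finset.sum_mul]
    exact Finset.sum_congr rfl fun j _ => by ring
  · rw [Submodule.span_singleton_le_iff_mem]
    intro f hf
    rw [vanishingIdeal_curve, RingHom.mem_ker] at hf
    have h := congrArg (Polynomial.eval s) (derivative_aeval_curve φ f)
    rw [hf] at h
    simpa [Polynomial.eval_finsetSum, eval_aeval_curve, velocity] using h.symm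

/-- Differentiating σ(φ(s)) = s would give 1 = 0. This is valid in every characteristic. -/
lemma velocity_ne_zero (hσ : MvPolynomial.aeval φ σ = Polynomial.X) (s : F) :
    velocity φ s ≠ 0 := by
  intro h0
  have h := congrArg (Polynomial.eval s) (derivative_aeval_curve φ σ)
  rw [hσ] at h
  have h1 (i) : (Polynomial.derivative (φ i)).eval s = 0 := congrFun h0 i
  simp [Polynomial.eval_finsetSum, h1] at h

lemma finrank_tangentSpace_curve [Infinite F] (hσ : MvPolynomial.aeval φ σ = Polynomial.X)
    (s : F) : Module.finrank F (tangentSpace (curve φ) (fun i => (φ i).eval s)) = 1 := by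
  rw [tangentSpace_curve hσ, finrank_span_singleton (velocity_ne_zero hσ s)]

/-- An irreducible closed set covered by finitely many closed sets lies in one of them. -/
lemma IsIrreducibleClosed.exists_subset {ι : Type*} (T : Finset ι) {V : ι → Set (Fin 3 → F)}
    (hV : ∀ i ∈ T, IsIrreducibleClosed (V i)) {W : Set (Fin 3 → F)} (hW : IsIrreducibleClosed W)
    (h : W ⊆ ⋃ i ∈ T, V i) : ∃ i ∈ T, W ⊆ V i := by
  by_contra! hc
  -- For each piece, choose an equation that fails somewhere on W; the product of these vanishes on
  -- W, against primality.
  have hf : ∀ i ∈ T, ∃ f ∈ MvPolynomial.vanishingIdeal F (V i),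
      f ∉ MvPolynomial.vanishingIdeal F W := by
    intro i hi
    obtain ⟨P, hPW, hPV⟩ := Set.not_subset.1 (hc i hi)
    obtain ⟨I, hI⟩ := (hV i hi).1
    rw [hI, MvPolynomial.mem_zeroLocus_iff] at hPV
    push Not at hPV
    obtain ⟨f, hfI, hfP⟩ := hPV
    refine ⟨f, fun Q hQ => ?_, fun hfW => hfP (hfW P hPW)⟩
    rw [hI] at hQ
    exact hQ f hfI
  choose! f hfV hfW using hf
  have hprod : ∏ i ∈ T, f i ∈ MvPolynomial.vanishingIdeal F W := by
    intro P hP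
    obtain ⟨i, hi, hPi⟩ := Set.mem_iUnion₂.1 (h hP)
    rw [map_prod]
    exact Finset.prod_eq_zero hi (hfV i hi P hPi)
  have := hW.2
  obtain ⟨i, hi, hfi⟩ := (Ideal.IsPrime.prod_mem_iff).1 hprod
  exact hfW i hi hfi

/-- The polynomial curve parametrizing the vertical line through `(x, y, 0)`. -/
noncomputable def lineParam (x y : F) : Fin 3 → Polynomial F :=
  ![Polynomial.C x, Polynomial.C y, Polynomial.X]

lemma aeval_lineParam (x y : F) :
    MvPolynomial.aeval (lineParam x y) (MvPolynomial.X 2 : MvPolynomial (Fin 3) F) = Polynomial.X := by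
  simp [lineParam]

lemma mem_curve_lineParam {x y : F} {P : Fin 3 → F} :
    P ∈ curve (lineParam x y) ↔ P 0 = x ∧ P 1 = y := by
  constructor
  · rintro ⟨s, rfl⟩
    simp [lineParam]
  · rintro ⟨rfl, rfl⟩
    refine ⟨P 2, funext fun i => ?_⟩
    fin_cases i <;> simp [lineParam]

lemma velocity_lineParam (x y s : F) : velocity (lineParam x y) s = ![0, 0, 1] := by
  ext i
  fin_cases i <;> simp [velocity, lineParam]

end Curves

/-! ### Chebyshev polynomials and the parametrization of X^ab -/

section Chebyshev

open Polynomial.Chebyshev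

variable {F : Type*} [Field F]

lemma eval_C_add_inv {t : F} (ht : t ≠ 0) (k : ℤ) :
    (C F k).eval (t + t⁻¹) = t ^ k + t ^ (-k) := by
  induction k using Polynomial.Chebyshev.induct with
  | zero => simp; norm_num
  | one => simp
  | add_two k h1 h2 =>
    rw [C_add_two, Polynomial.eval_sub, Polynomial.eval_mul, Polynomial.eval_X, h1, h2]
    simp only [neg_add, zpow_add₀ ht, zpow_neg, zpow_natCast, zpow_ofNat]
    field_simp
    ring
  | neg_add_one k h1 h2 =>
    rw [C_sub_one, Polynomial.eval_sub, Polynomial.eval_mul, Polynomial.eval_X, h1, h2]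
    simp only [neg_add, neg_sub, neg_neg, zpow_add₀ ht, zpow_sub₀ ht, zpow_neg, zpow_natCast,
      zpow_one]
    field_simp
    ring

/-- Turns a zero of S_{k-1} into t^k = t⁻ᵏ. It says nothing at t = ±1, where `ne_inv_of_S_eq_zero`
is needed. The index is an integer, so k = 0 refers to S_{-1} = 0. -/
lemma eval_S_add_inv {t : F} (ht : t ≠ 0) (k : ℕ) :
    (S F (k - 1 : ℤ)).eval (t + t⁻¹) * (t - t⁻¹) = t ^ k - (t ^ k)⁻¹ := by
  induction k using Nat.twoStepInduction with
  | zero => simp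
  | one => simp
  | more k h1 h2 =>
    have : ((k + 2 : ℕ) - 1 : ℤ) = (k - 1 : ℤ) + 2 := by push_cast; ring
    have h3 : ((k + 1 : ℕ) - 1 : ℤ) = (k - 1 : ℤ) + 1 := by push_cast; ring
    rw [h3] at h2
    rw [this, S_add_two, Polynomial.eval_sub, Polynomial.eval_mul, Polynomial.eval_X, sub_mul,
      mul_assoc, h1, h2]
    field_simp
    ring

lemma derivative_C (k : ℕ) :
    Polynomial.derivative (C F k) = (k : Polynomial F) * S F (k - 1) := by
  induction k using Nat.twoStepInduction with
  | zero => simp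
  | one => simp
  | more k h1 h2 =>
    have e1 : ((k + 2 : ℕ) : ℤ) = (k : ℤ) + 2 := by push_cast; ring
    have e2 : ((k + 1 : ℕ) : ℤ) = (k : ℤ) + 1 := by push_cast; ring
    have e3 : (k + 2 - 1 : ℤ) = k + 1 := by ring
    have h4 := C_eq_S_sub_X_mul_S F (k + 1 : ℤ)
    have h5 := S_add_one F (k : ℤ)
    rw [e2] at h2
    rw [e1, C_add_two, Polynomial.derivative_sub, Polynomial.derivative_mul,
      Polynomial.derivative_X, h1, h2, e3]
    simp only [add_sub_cancel_right] at h4 ⊢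
    push_cast
    linear_combination h4 - (k : Polynomial F) * h5

lemma exists_add_inv_eq [IsAlgClosed F] (s : F) : ∃ t : F, t ≠ 0 ∧ t + t⁻¹ = s := by
  obtain ⟨t, ht⟩ := IsAlgClosed.exists_root
    (Polynomial.X ^ 2 - Polynomial.C s * Polynomial.X + 1 : Polynomial F)
    (by
      have h : (Polynomial.X ^ 2 - Polynomial.C s * Polynomial.X + 1 : Polynomial F).degree = 2 := by
        compute_degree!
      simp [h])
  simp only [Polynomial.IsRoot, Polynomial.eval_add, Polynomial.eval_sub, Polynomial.eval_pow,
    Polynomial.eval_X, Polynomial.eval_mul, Polynomial.eval_C, Polynomial.eval_one] at ht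
  have h0 : t ≠ 0 := by
    rintro rfl
    simp at ht
  refine ⟨t, h0, ?_⟩
  field_simp
  linear_combination ht

lemma add_inv_eq_add_inv {a b : F} (ha : a ≠ 0) (hb : b ≠ 0) (h : a + a⁻¹ = b + b⁻¹) :
    a = b ∨ a = b⁻¹ := by
  have : (a - b) * (a - b⁻¹) = 0 := by
    field_simp at h ⊢
    linear_combination h
  rcases mul_eq_zero.1 this with h | h
  · exact Or.inl (sub_eq_zero.1 h)
  · exact Or.inr (sub_eq_zero.1 h)

/-- The product formula C_v C_w = C_{v+w} + C_{v-w} is a two-term recurrence along the progression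
of step w, and it runs in both directions. -/
lemma C_mem_of_mem {K : Subalgebra F (Polynomial F)} {u w : ℤ} (hu : C F u ∈ K) (hw : C F w ∈ K)
    (huw : C F (u + w) ∈ K) (k : ℤ) : C F (u + k * w) ∈ K := by
  have key : ∀ k : ℤ, C F (u + k * w) ∈ K ∧ C F (u + (k + 1) * w) ∈ K := by
    intro k
    induction k using Int.induction_on with
    | zero => simpa using ⟨hu, huw⟩
    | succ i ih =>
      refine ⟨ih.2, ?_⟩
      have h := C_mul_C F (u + (i + 1) * w) w
      have e1 : u + (i + 1) * w + w = u + (i + 1 + 1) * w := by ring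
      have e2 : u + (i + 1) * w - w = u + i * w := by ring
      rw [e1, e2] at h
      rw [← sub_eq_iff_eq_add.2 h]
      exact K.sub_mem (K.mul_mem ih.2 hw) ih.1
    | pred i ih =>
      have e : u + (-i - 1 + 1) * w = u + -i * w := by ring
      refine ⟨?_, e ▸ ih.1⟩
      have h := C_mul_C F (u + -i * w) w
      have e1 : u + -i * w + w = u + (-i + 1) * w := by ring
      have e2 : u + -i * w - w = u + (-i - 1) * w := by ring
      rw [e1, e2] at h
      rw [← sub_eq_iff_eq_add'.2 h]
      exact K.sub_mem (K.mul_mem ih.1 hw) ih.2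
  exact (key k).1

/-- The parametrization of the abelian characters by `s = t + t⁻¹`, where `t` is the eigenvalue
of the meridian. -/
noncomputable def abParam (F : Type*) [Field F] (m n : ℕ) : Fin 3 → Polynomial F :=
  ![C F n, C F m, C F (n - m)]

/-- The subalgebra generated by the coordinates contains C_{an+bm} for all integers a, b, hence C_1
= X by Bézout. The third coordinate is what yields C_{m+n} = C_n C_m - C_{n-m} and starts the
recurrence in the second direction. -/
lemma exists_aeval_abParam {m n : ℕ} (hmn : Nat.Coprime m n) :
    ∃ σ : MvPolynomial (Fin 3) F, MvPolynomial.aeval (abParam F m n) σ = Polynomial.X := by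
  set K := (MvPolynomial.aeval (abParam F m n) :
    MvPolynomial (Fin 3) F →ₐ[F] Polynomial F).range
  have hn : C F n ∈ K := ⟨MvPolynomial.X 0, by simp [abParam]⟩
  have hm : C F m ∈ K := ⟨MvPolynomial.X 1, by simp [abParam]⟩
  have hd : C F (n - m) ∈ K := ⟨MvPolynomial.X 2, by simp [abParam]⟩
  have h0 : C F 0 ∈ K := by
    rw [C_zero]
    exact ofNat_mem K 2
  have hs : C F (m + n) ∈ K := by
    have h := C_mul_C F (n : ℤ) m
    rw [add_comm (m : ℤ), ← sub_eq_iff_eq_add.2 h]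
    exact K.sub_mem (K.mul_mem hn hm) hd
  have hrow0 (a : ℤ) : C F (a * n) ∈ K := by
    simpa using C_mem_of_mem h0 hn (by simpa using hn) a
  have hrow1 (a : ℤ) : C F (m + a * n) ∈ K := C_mem_of_mem hm hn hs a
  have hall (a b : ℤ) : C F (a * n + b * m) ∈ K :=
    C_mem_of_mem (hrow0 a) hm (by simpa [add_comm] using hrow1 a) b
  have hb := Nat.gcd_eq_gcd_ab n m
  rw [hmn.symm.gcd_eq_one] at hb
  have h := hall (n.gcdA m) (n.gcdB m)
  rw [mul_comm _ (n : ℤ), mul_comm _ (m : ℤ), ← hb, Nat.cast_one, C_one] at h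
  exact h

/-- A common root of two powers with coprime exponents. -/
lemma exists_pow_eq_pow {m n : ℕ} (hmn : Nat.Coprime m n) {a b : F} (ha : a ≠ 0) (hb : b ≠ 0)
    (h : a ^ m = b ^ n) : ∃ t : F, t ≠ 0 ∧ t ^ n = a ∧ t ^ m = b := by
  have hg := Nat.gcd_eq_gcd_ab n m
  rw [hmn.symm.gcd_eq_one] at hg
  set u := n.gcdA m
  set v := n.gcdB m
  have h' : a ^ (m : ℤ) = b ^ (n : ℤ) := by simpa using h
  -- Since nu + mv = 1, any solution must be t = (t^n)^u (t^m)^v = a^u b^v.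
  refine ⟨a ^ u * b ^ v, mul_ne_zero (zpow_ne_zero _ ha) (zpow_ne_zero _ hb), ?_, ?_⟩
  · calc (a ^ u * b ^ v) ^ n = a ^ (n * u) * (b ^ (n : ℤ)) ^ v := by
          rw [mul_pow, ← zpow_natCast, ← zpow_natCast, ← zpow_mul, ← zpow_mul, ← zpow_mul,
            mul_comm u, mul_comm v]
      _ = a := by
          rw [← h', ← zpow_mul, ← zpow_add₀ ha, ← hg]
          simp
  · calc (a ^ u * b ^ v) ^ m = (a ^ (m : ℤ)) ^ u * b ^ (m * v) := by
          rw [mul_pow, ← zpow_natCast, ← zpow_natCast, ← zpow_mul, ← zpow_mul, ← zpow_mul,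
            mul_comm u, mul_comm v]
      _ = b := by
          rw [h', ← zpow_mul, ← zpow_add₀ hb, ← hg]
          simp

lemma eval_abParam (m n : ℕ) {t : F} (ht : t ≠ 0) :
    (fun i => (abParam F m n i).eval (t + t⁻¹)) =
      ![t ^ n + (t ^ n)⁻¹, t ^ m + (t ^ m)⁻¹, t ^ n * (t ^ m)⁻¹ + (t ^ n)⁻¹ * t ^ m] := by
  ext i
  fin_cases i
  · simp [abParam, eval_C_add_inv ht]
  · simp [abParam, eval_C_add_inv ht]
  · simp [abParam, eval_C_add_inv ht, zpow_sub₀ ht, div_eq_mul_inv, mul_comm]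

/-- The Chebyshev polynomials of the second kind give the powers of a `2 × 2` matrix of
determinant one. -/
lemma pow_eq_S_smul {A : Matrix (Fin 2) (Fin 2) F} (hA : A.det = 1) (k : ℕ) :
    A ^ k = (S F (k - 1)).eval A.trace • A - (S F (k - 2)).eval A.trace • 1 := by
  have hsq : A * A = A.trace • A - (1 : F) • 1 := by
    have h := Matrix.aeval_self_charpoly A
    rw [Matrix.charpoly_fin_two, hA] at h
    simp only [map_add, map_sub, map_mul, Polynomial.aeval_X, Polynomial.aeval_C,
      Algebra.algebraMap_eq_smul_one, smul_mul_assoc, one_mul, pow_two] at h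
    linear_combination (norm := module) h
  induction k with
  | zero => simp
  | succ k ih =>
    rw [pow_succ, ih, sub_mul, smul_mul_assoc, hsq, smul_mul_assoc, one_mul]
    have e1 : ((k + 1 : ℕ) - 1 : ℤ) = k := by push_cast; ring
    have e2 : ((k + 1 : ℕ) - 2 : ℤ) = k - 1 := by push_cast; ring
    rw [e1, e2, S_eq F k, Polynomial.eval_sub, Polynomial.eval_mul, Polynomial.eval_X]
    module

lemma pow_add_S_eq_zero {a : F} (ha : a ≠ 0) {k : ℕ} (h : (S F (k - 1)).eval (a + a⁻¹) = 0) :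
    a ^ k = -(S F (k - 2)).eval (a + a⁻¹) := by
  have h' := congrFun (congrFun (pow_eq_S_smul (A := Matrix.diagonal ![a, a⁻¹])
    (by simp [ha]) k) 0) 0
  simpa [Matrix.diagonal_pow, Matrix.trace, h] using h'

/-- Otherwise t^{2k} = 1 for every nonzero t, impossible in an infinite field. The finiteness of
`lineBase` rests on this. -/
lemma S_sub_one_ne_zero [Infinite F] {k : ℕ} (hk : 0 < k) : S F (k - 1) ≠ 0 := by
  intro h0
  have h : (Polynomial.X ^ (2 * k + 1) - Polynomial.X : Polynomial F) = 0 := by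
    refine Polynomial.funext fun t => ?_
    rcases eq_or_ne t 0 with rfl | ht
    · simp
    · have h1 := eval_S_add_inv ht k
      rw [h0, Polynomial.eval_zero, zero_mul] at h1
      have h2 := mul_inv_cancel₀ (pow_ne_zero k ht)
      simp only [Polynomial.eval_sub, Polynomial.eval_pow, Polynomial.eval_X, Polynomial.eval_zero]
      rw [pow_succ, two_mul, pow_add]
      linear_combination (-t ^ k * t) * h1 + t * h2
  have h2 := congrArg (Polynomial.coeff · 1) h
  simp [Polynomial.coeff_X_pow, hk.ne'] at h2

end Chebyshev

/-! ### Pairs of matrices with A^m = B^n -/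

section Representations

open Matrix

variable {F : Type*} [Field F]

lemma val_mul (A B : SpecialLinearGroup (Fin 2) F) : (A * B).val = A.val * B.val := rfl

lemma val_pow (A : SpecialLinearGroup (Fin 2) F) (k : ℕ) : (A ^ k).val = A.val ^ k :=
  A.coe_pow k

lemma val_inv (A : SpecialLinearGroup (Fin 2) F) : (A⁻¹).val = A.val.adjugate := rfl

/-- The coordinates of the pair `(A, B)`. -/
def pairCoords (A B : SpecialLinearGroup (Fin 2) F) : Fin 3 → F :=
  ![A.val.trace, B.val.trace, (A * B⁻¹).val.trace]

lemma genA_pow_eq (m n : ℕ) : genA m n ^ m = genB m n ^ n := by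
  have h : (QuotientGroup.mk (FreeGroup.of 0 ^ m * (FreeGroup.of 1 ^ n)⁻¹) : KnotGroup m n) = 1 :=
    PresentedGroup.one_of_mem (Set.mem_singleton _)
  exact mul_inv_eq_one.1 h

lemma exists_representation {m n : ℕ} {A B : SpecialLinearGroup (Fin 2) F}
    (h : A ^ m = B ^ n) :
    ∃ ρ : KnotGroup m n →* SpecialLinearGroup (Fin 2) F, ρ (genA m n) = A ∧ ρ (genB m n) = B := by
  have hr : ∀ r ∈ ({FreeGroup.of 0 ^ m * (FreeGroup.of 1 ^ n)⁻¹} : Set (FreeGroup (Fin 2))),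
      FreeGroup.lift ![A, B] r = 1 := by
    rintro r rfl
    simp [h]
  refine ⟨PresentedGroup.toGroup hr, ?_, ?_⟩
  · exact PresentedGroup.toGroup.of hr
  · exact PresentedGroup.toGroup.of hr

lemma commute_of_commute_generators {m n : ℕ}
    (ρ : KnotGroup m n →* SpecialLinearGroup (Fin 2) F)
    (h : Commute (ρ (genA m n)) (ρ (genB m n))) (g k : KnotGroup m n) :
    Commute (ρ g) (ρ k) := by
  have step (x : SpecialLinearGroup (Fin 2) F) (hA : Commute x (ρ (genA m n)))
      (hB : Commute x (ρ (genB m n))) (g : KnotGroup m n) : Commute x (ρ g) := by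
    have hg : g ∈ (Subgroup.centralizer {x}).comap ρ := by
      have htop : (Subgroup.centralizer {x}).comap ρ = ⊤ := by
        rw [eq_top_iff, ← PresentedGroup.closure_range_of, Subgroup.closure_le]
        rintro _ ⟨i, rfl⟩
        rw [SetLike.mem_coe, Subgroup.mem_comap, Subgroup.mem_centralizer_singleton_iff]
        fin_cases i
        · exact hA.eq.symm
        · exact hB.eq.symm
      rw [htop]
      trivial
    rw [Subgroup.mem_comap, Subgroup.mem_centralizer_singleton_iff] at hg
    exact hg.symm
  exact (step _ (step _ (Commute.refl _) h g).symm (step _ h.symm (Commute.refl _) g).symm k)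

lemma mem_X_iff {m n : ℕ} {P : Fin 3 → F} :
    P ∈ X m n F ↔ ∃ A B : SpecialLinearGroup (Fin 2) F, A ^ m = B ^ n ∧ P = pairCoords A B := by
  constructor
  · rintro ⟨_, ⟨ρ, rfl⟩, rfl⟩
    refine ⟨ρ (genA m n), ρ (genB m n), ?_, ?_⟩
    · rw [← map_pow, genA_pow_eq, map_pow]
    · rw [pairCoords, ← map_inv, ← map_mul]
      rfl
  · rintro ⟨A, B, h, rfl⟩
    obtain ⟨ρ, rfl, rfl⟩ := exists_representation h
    refine ⟨_, ⟨ρ, rfl⟩, ?_⟩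
    rw [pairCoords, ← map_inv, ← map_mul]
    rfl

lemma mem_Xab_iff {m n : ℕ} {P : Fin 3 → F} :
    P ∈ Xab m n F ↔ ∃ A B : SpecialLinearGroup (Fin 2) F,
      Commute A B ∧ A ^ m = B ^ n ∧ P = pairCoords A B := by
  constructor
  · rintro ⟨_, ⟨ρ, hρ, rfl⟩, rfl⟩
    refine ⟨ρ (genA m n), ρ (genB m n), hρ _ _, ?_, ?_⟩
    · rw [← map_pow, genA_pow_eq, map_pow]
    · rw [pairCoords, ← map_inv, ← map_mul]
      rfl
  · rintro ⟨A, B, hAB, h, rfl⟩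
    obtain ⟨ρ, rfl, rfl⟩ := exists_representation h
    refine ⟨_, ⟨ρ, commute_of_commute_generators ρ hAB, rfl⟩, ?_⟩
    rw [pairCoords, ← map_inv, ← map_mul]
    rfl

lemma exists_eigenvector [IsAlgClosed F] (A : Matrix (Fin 2) (Fin 2) F) :
    ∃ (a : F) (v : Fin 2 → F), v ≠ 0 ∧ A *ᵥ v = a • v := by
  obtain ⟨a, ha⟩ := Module.End.exists_eigenvalue (Matrix.toLin' A)
  obtain ⟨v, hv⟩ := ha.exists_hasEigenvector
  exact ⟨a, v, hv.2, by simpa using hv.apply_eq_smul⟩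

lemma exists_common_eigenvector [IsAlgClosed F] {A B : Matrix (Fin 2) (Fin 2) F}
    (h : Commute A B) :
    ∃ (a b : F) (v : Fin 2 → F), v ≠ 0 ∧ A *ᵥ v = a • v ∧ B *ᵥ v = b • v := by
  obtain ⟨a, v, hv, hAv⟩ := exists_eigenvector A
  -- If v is not an eigenvector of B, then v and Bv form a basis on which A acts as the scalar a, so
  -- any eigenvector of B works.
  by_cases hB : ∃ b : F, B *ᵥ v = b • v
  · obtain ⟨b, hb⟩ := hB
    exact ⟨a, b, v, hv, hAv, hb⟩
  · push Not at hB
    have hli : LinearIndependent F ![v, B *ᵥ v] := by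
      rw [LinearIndependent.pair_iff' hv]
      exact fun c hc => hB c hc.symm
    have hspan := hli.span_eq_top_of_card_eq_finrank (by simp)
    have hABv : A *ᵥ (B *ᵥ v) = a • (B *ᵥ v) := by
      rw [mulVec_mulVec, h.eq, ← mulVec_mulVec, hAv, mulVec_smul]
    have hA : ∀ w, A *ᵥ w = a • w := by
      intro w
      have hw : w ∈ Submodule.span F (Set.range ![v, B *ᵥ v]) := hspan ▸ Submodule.mem_top
      induction hw using Submodule.span_induction with
      | mem x hx =>
        obtain ⟨i, rfl⟩ := hx
        fin_cases i
        · exact hAv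
        · exact hABv
      | zero => simp
      | add x y _ _ hx hy => rw [mulVec_add, hx, hy, smul_add]
      | smul c x _ hx => rw [mulVec_smul, hx, smul_comm]
    obtain ⟨b, w, hw, hBw⟩ := exists_eigenvector B
    exact ⟨a, b, w, hw, hA w, hBw⟩

lemma eigenvalue_ne_zero {A : SpecialLinearGroup (Fin 2) F} {a : F} {v : Fin 2 → F} (hv : v ≠ 0)
    (h : A.val *ᵥ v = a • v) : a ≠ 0 := by
  rintro rfl
  rw [zero_smul] at h
  exact A.det_ne_zero (exists_mulVec_eq_zero_iff.1 ⟨v, hv, h⟩)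

lemma trace_eq_add_inv {A : SpecialLinearGroup (Fin 2) F} {a : F} {v : Fin 2 → F} (hv : v ≠ 0)
    (h : A.val *ᵥ v = a • v) : A.val.trace = a + a⁻¹ := by
  have ha := eigenvalue_ne_zero hv h
  have hdet : (A.val - a • 1).det = 0 :=
    exists_mulVec_eq_zero_iff.1 ⟨v, hv, by rw [sub_mulVec, h, smul_mulVec, one_mulVec, sub_self]⟩
  have h1 := A.property
  rw [det_fin_two] at h1 hdet
  simp at hdet
  rw [trace_fin_two]
  field_simp
  linear_combination h1 - hdet

lemma pow_mulVec_eq {A : Matrix (Fin 2) (Fin 2) F} {a : F} {v : Fin 2 → F}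
    (h : A *ᵥ v = a • v) (k : ℕ) : (A ^ k) *ᵥ v = a ^ k • v := by
  induction k with
  | zero => simp
  | succ k ih => rw [pow_succ, ← mulVec_mulVec, h, mulVec_smul, ih, smul_smul, pow_succ']

/-- The diagonal matrix with eigenvalues `a` and `a⁻¹`, as an element of `SL₂`. -/
def diagSL (a : F) (ha : a ≠ 0) : SpecialLinearGroup (Fin 2) F :=
  ⟨!![a, 0; 0, a⁻¹], by simp [det_fin_two, ha]⟩

lemma Xab_eq_curve [IsAlgClosed F] {m n : ℕ} (hmn : Nat.Coprime m n) :
    Xab m n F = curve (abParam F m n) := by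
  ext P
  rw [mem_Xab_iff]
  constructor
  · rintro ⟨A, B, hAB, hpow, rfl⟩
    obtain ⟨a, b, v, hv, hA, hB⟩ :=
      exists_common_eigenvector (hAB.map SpecialLinearGroup.coeMonoidHom)
    simp only [SpecialLinearGroup.coeMonoidHom_apply] at hA hB
    have ha := eigenvalue_ne_zero hv hA
    have hb := eigenvalue_ne_zero hv hB
    have hab : a ^ m = b ^ n := by
      have h1 := pow_mulVec_eq hA m
      rw [← val_pow, hpow, val_pow, pow_mulVec_eq hB] at h1
      exact (smul_left_injective F hv h1).symm
    have hC : (A * B⁻¹).val *ᵥ v = (a * b⁻¹) • v := by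
      have hB' : (B⁻¹).val *ᵥ v = b⁻¹ • v := by
        have h1 : (B⁻¹).val *ᵥ (B.val *ᵥ v) = v := by
          rw [mulVec_mulVec, ← val_mul, inv_mul_cancel]
          exact one_mulVec v
        rw [hB, mulVec_smul] at h1
        rw [← h1, smul_smul, inv_mul_cancel₀ hb, one_smul, h1]
      rw [val_mul, ← mulVec_mulVec, hB', mulVec_smul, hA, smul_smul, mul_comm]
    obtain ⟨t, ht, rfl, rfl⟩ := exists_pow_eq_pow hmn ha hb hab
    refine ⟨t + t⁻¹, ?_⟩
    refine (eval_abParam m n ht).trans ?_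
    rw [pairCoords, trace_eq_add_inv hv hA, trace_eq_add_inv hv hB,
      trace_eq_add_inv hv hC, mul_inv, inv_inv]
  · rintro ⟨s, rfl⟩
    obtain ⟨t, ht, rfl⟩ := exists_add_inv_eq s
    have hpow (k : ℕ) : diagSL t ht ^ k = diagSL (t ^ k) (pow_ne_zero k ht) := by
      apply Subtype.ext
      rw [val_pow]
      induction k with
      | zero => simp [diagSL, one_fin_two]
      | succ k ih =>
        rw [pow_succ, ih]
        simp [diagSL, pow_succ, mul_comm]
    refine ⟨diagSL t ht ^ n, diagSL t ht ^ m, (Commute.refl _).pow_pow _ _, ?_, ?_⟩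
    · rw [← pow_mul, ← pow_mul, mul_comm]
    · refine (eval_abParam m n ht).trans ?_
      rw [pairCoords, hpow, hpow, val_mul, val_inv]
      simp [diagSL, trace_fin_two, adjugate_fin_two]

/-- The points `(x, y)` for which the whole vertical line above `(x, y)` consists of characters
with `A ^ m = B ^ n` central. -/
def lineBase (m n : ℕ) (F : Type*) [Field F] : Set (F × F) :=
  {q | (Polynomial.Chebyshev.S F (m - 1)).eval q.1 = 0 ∧
    (Polynomial.Chebyshev.S F (n - 1)).eval q.2 = 0 ∧
    (Polynomial.Chebyshev.S F (m - 2)).eval q.1 = (Polynomial.Chebyshev.S F (n - 2)).eval q.2}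

lemma lineBase_finite [Infinite F] {m n : ℕ} (hm : 0 < m) (hn : 0 < n) :
    (lineBase m n F).Finite := by
  refine ((Polynomial.finite_setOfPred_isRoot (S_sub_one_ne_zero hm)).prod
    (Polynomial.finite_setOfPred_isRoot (S_sub_one_ne_zero hn))).subset ?_
  rintro q ⟨h1, h2, -⟩
  exact ⟨h1, h2⟩

/-- Over a point of `lineBase`, the traces alone force A^m and B^n to be the same scalar matrix, so
tr(AB⁻¹) may be prescribed freely. -/
lemma curve_lineParam_subset_X [IsAlgClosed F] {m n : ℕ} {q : F × F} (hq : q ∈ lineBase m n F) :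
    curve (lineParam q.1 q.2) ⊆ X m n F := by
  intro P hP
  obtain ⟨h0, h1⟩ := mem_curve_lineParam.1 hP
  obtain ⟨hm, hn, hmn⟩ := hq
  obtain ⟨a, ha, hax⟩ := exists_add_inv_eq q.1
  obtain ⟨b, hb, hby⟩ := exists_add_inv_eq q.2
  -- If c is the lower-left entry of B, then tr(AB⁻¹) = ab⁻¹ + a⁻¹b - c; c is chosen to make this
  -- the third coordinate of P.
  let A : SpecialLinearGroup (Fin 2) F := ⟨!![a, 1; 0, a⁻¹], by simp [det_fin_two, ha]⟩
  let B : SpecialLinearGroup (Fin 2) F :=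
    ⟨!![b, 0; a * b⁻¹ + a⁻¹ * b - P 2, b⁻¹], by simp [det_fin_two, hb]⟩
  have hA : A.val.trace = q.1 := by simp [A, trace_fin_two, hax]
  have hB : B.val.trace = q.2 := by simp [B, trace_fin_two, hby]
  rw [mem_X_iff]
  refine ⟨A, B, ?_, ?_⟩
  · apply Subtype.ext
    rw [val_pow, val_pow, pow_eq_S_smul A.property,
      pow_eq_S_smul B.property, hA, hB, hm, hn, hmn, zero_smul, zero_smul]
  · rw [pairCoords, hA, hB]
    ext i
    fin_cases i
    · exact h0
    · exact h1
    · change P 2 = (A * B⁻¹).val.trace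
      rw [val_mul, val_inv]
      simp [A, B, trace_fin_two, adjugate_fin_two]
      ring

lemma X_subset [IsAlgClosed F] {m n : ℕ} :
    X m n F ⊆ Xab m n F ∪ ⋃ q ∈ lineBase m n F, curve (lineParam q.1 q.2) := by
  intro P hP
  obtain ⟨A, B, h, rfl⟩ := mem_X_iff.1 hP
  by_cases hc : Commute A B
  · exact Or.inl (mem_Xab_iff.2 ⟨A, B, hc, h, rfl⟩)
  · right
    have hcv : ¬ Commute A.val B.val := fun hc' => hc (Subtype.ext hc'.eq)
    have h' := congrArg Subtype.val h
    rw [val_pow, val_pow] at h'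
    have hA : Commute (B.val ^ n) A.val := h' ▸ (Commute.refl A.val).pow_left m
    have hB : Commute (A.val ^ m) B.val := h'.symm ▸ (Commute.refl B.val).pow_left n
    -- Applied to A^m = cA - d and B, then to B^n and A: a nonzero leading coefficient would make A
    -- and B commute.
    have hs (M N : Matrix (Fin 2) (Fin 2) F) (c d : F) (hMN : ¬ Commute M N)
        (hcomm : Commute (c • M - d • (1 : Matrix (Fin 2) (Fin 2) F)) N) : c = 0 := by
      by_contra hc0
      apply hMN
      have h1 := hcomm.add_left ((Commute.one_left N).smul_left d)
      rw [sub_add_cancel] at h1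
      have h2 := h1.smul_left c⁻¹
      rwa [smul_smul, inv_mul_cancel₀ hc0, one_smul] at h2
    rw [pow_eq_S_smul A.property] at hB h'
    rw [pow_eq_S_smul B.property] at hA h'
    have hSA := hs _ _ _ _ hcv hB
    have hSB := hs _ _ _ _ (fun h => hcv h.symm) hA
    refine Set.mem_iUnion₂.2 ⟨(A.val.trace, B.val.trace), ⟨hSA, hSB, ?_⟩,
      mem_curve_lineParam.2 ⟨rfl, rfl⟩⟩
    rw [hSA, hSB] at h'
    simpa using congrFun (congrFun h' 0) 0

end Representations

/-! ### Components of X, their intersections and tangents -/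

section Components

open Polynomial.Chebyshev

variable {F : Type*} [Field F] {m n : ℕ}

lemma Xab_subset_X : Xab m n F ⊆ X m n F := by
  rintro _ ⟨_, ⟨ρ, -, rfl⟩, rfl⟩
  exact ⟨_, ⟨ρ, rfl⟩, rfl⟩

/-- The coordinates of the abelian character sending `a`, `b` to `diag(a, a⁻¹)`,
`diag(b, b⁻¹)`. -/
def diagCoords (a b : F) : Fin 3 → F := ![a + a⁻¹, b + b⁻¹, a * b⁻¹ + a⁻¹ * b]

lemma diagCoords_inv_left (a b : F) : diagCoords a⁻¹ b = diagCoords a b⁻¹ := by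
  simp [diagCoords, add_comm]

lemma diagCoords_ne {a b : F} (ha' : a ≠ a⁻¹) (hb' : b ≠ b⁻¹) :
    diagCoords a b ≠ diagCoords a b⁻¹ := by
  intro h
  have h2 : a * b⁻¹ + a⁻¹ * b = a * b⁻¹⁻¹ + a⁻¹ * b⁻¹ := congrFun h 2
  rw [inv_inv] at h2
  have : (a - a⁻¹) * (b - b⁻¹) = 0 := by linear_combination -h2
  rcases mul_eq_zero.1 this with h | h
  · exact ha' (sub_eq_zero.1 h)
  · exact hb' (sub_eq_zero.1 h)

lemma exists_param_diagCoords (hmn : Nat.Coprime m n) {a b : F} (ha : a ≠ 0) (hb : b ≠ 0)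
    (h : a ^ m = b ^ n) : ∃ t : F, t ≠ 0 ∧ t ^ n = a ∧ t ^ m = b ∧
      (fun i => (abParam F m n i).eval (t + t⁻¹)) = diagCoords a b := by
  obtain ⟨t, ht, rfl, rfl⟩ := exists_pow_eq_pow hmn ha hb h
  exact ⟨t, ht, rfl, rfl, eval_abParam m n ht⟩

lemma pow_eq_inv_of_S_eq_zero {a : F} (ha : a ≠ 0) {k : ℕ}
    (h : (S F (k - 1)).eval (a + a⁻¹) = 0) : a ^ k = (a⁻¹) ^ k := by
  have := eval_S_add_inv ha k
  rw [h, zero_mul] at this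
  rw [inv_pow]
  exact (sub_eq_zero.1 this.symm)

lemma pow_eq_pow_of_mem_lineBase {a b : F} (ha : a ≠ 0) (hb : b ≠ 0)
    (hq : (a + a⁻¹, b + b⁻¹) ∈ lineBase m n F) : a ^ m = b ^ n ∧ a ^ m = b⁻¹ ^ n := by
  obtain ⟨h1, h2, h3⟩ := hq
  have h := pow_add_S_eq_zero ha h1
  rw [h3, ← pow_add_S_eq_zero hb h2] at h
  exact ⟨h, h.trans (pow_eq_inv_of_S_eq_zero hb h2)⟩

/-- If a = ±1, then S_{k-1} is evaluated at ±2, where its value is ±k. This is where the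
characteristic enters. -/
lemma ne_inv_of_S_eq_zero {a : F} (ha : a ≠ 0) {k : ℕ} (hk : (k : F) ≠ 0)
    (h : (S F (k - 1)).eval (a + a⁻¹) = 0) : a ≠ a⁻¹ := by
  intro h'
  have h1 : a * a = 1 := by
    nth_rewrite 2 [h']
    exact mul_inv_cancel₀ ha
  apply hk
  rcases mul_self_eq_one_iff.1 h1 with rfl | rfl
  · rw [inv_one, one_add_one_eq_two, S_eval_two] at h
    simpa using h
  · rw [inv_neg, inv_one, ← neg_add, one_add_one_eq_two, S_eval_neg_two] at h
    simpa using h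

lemma velocity_abParam (s : F) : velocity (abParam F m n) s 0 = n * (S F (n - 1)).eval s ∧
    velocity (abParam F m n) s 1 = m * (S F (m - 1)).eval s := by
  simp [velocity, abParam, derivative_C]

lemma span_eq_iff_velocity (s : F) (hv : velocity (abParam F m n) s ≠ 0) :
    Submodule.span F {velocity (abParam F m n) s} = Submodule.span F {![0, 0, 1]} ↔
      velocity (abParam F m n) s 0 = 0 ∧ velocity (abParam F m n) s 1 = 0 := by
  constructor
  · intro h
    have hmem := h ▸ Submodule.mem_span_singleton_self (velocity (abParam F m n) s)
    obtain ⟨c, hc⟩ := Submodule.mem_span_singleton.1 hmem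
    rw [← hc]
    simp
  · rintro ⟨h0, h1⟩
    have h2 : velocity (abParam F m n) s = velocity (abParam F m n) s 2 • ![0, 0, 1] := by
      ext i
      fin_cases i <;> simp [h0, h1]
    have h3 : velocity (abParam F m n) s 2 ≠ 0 := by
      intro h3
      rw [h3, zero_smul] at h2
      exact hv h2
    rw [h2, Submodule.span_singleton_smul_eq (IsUnit.mk0 _ h3)]

variable [IsAlgClosed F]

lemma exists_mem_Xab_apply_eq (hmn : Nat.Coprime m n) (hm : 0 < m) (hn : 0 < n) (c : F) :
    (∃ P ∈ Xab m n F, P 0 = c) ∧ ∃ P ∈ Xab m n F, P 1 = c := by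
  obtain ⟨a, ha, rfl⟩ := exists_add_inv_eq c
  have hroot (k : ℕ) (hk : 0 < k) : ∃ t : F, t ≠ 0 ∧ t ^ k = a := by
    obtain ⟨t, ht⟩ := IsAlgClosed.exists_pow_nat_eq a hk
    refine ⟨t, ?_, ht⟩
    rintro rfl
    exact ha (by rw [← ht, zero_pow hk.ne'])
  rw [Xab_eq_curve hmn]
  constructor
  · obtain ⟨t, ht, rfl⟩ := hroot n hn
    refine ⟨_, ⟨t + t⁻¹, rfl⟩, ?_⟩
    exact congrFun (eval_abParam m n ht) _
  · obtain ⟨t, ht, rfl⟩ := hroot m hm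
    refine ⟨_, ⟨t + t⁻¹, rfl⟩, ?_⟩
    exact congrFun (eval_abParam m n ht) _

lemma not_Xab_subset_line (hmn : Nat.Coprime m n) (hm : 0 < m) (hn : 0 < n) (x y : F) :
    ¬ Xab m n F ⊆ curve (lineParam x y) := by
  intro h
  obtain ⟨P, hP, hP0⟩ := (exists_mem_Xab_apply_eq hmn hm hn (x + 1)).1
  have := (mem_curve_lineParam.1 (h hP)).1
  simp [hP0] at this

lemma isIrreducibleClosed_Xab (hmn : Nat.Coprime m n) : IsIrreducibleClosed (Xab m n F) := by
  have : Infinite F := IsAlgClosed.instInfinite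
  obtain ⟨σ, hσ⟩ := exists_aeval_abParam (F := F) hmn
  rw [Xab_eq_curve hmn]
  exact isIrreducibleClosed_curve hσ

lemma isIrreducibleClosed_line (x y : F) : IsIrreducibleClosed (curve (lineParam x y)) :=
  have : Infinite F := IsAlgClosed.instInfinite
  isIrreducibleClosed_curve (aeval_lineParam x y)

lemma subset_Xab_or_line (hmn : Nat.Coprime m n) (hm : 0 < m) (hn : 0 < n)
    {W : Set (Fin 3 → F)} (hWX : W ⊆ X m n F) (hW : IsIrreducibleClosed W) :
    W ⊆ Xab m n F ∨ ∃ q ∈ lineBase m n F, W ⊆ curve (lineParam q.1 q.2) := by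
  have : Infinite F := IsAlgClosed.instInfinite
  let T : Finset (Option (F × F)) := Finset.insertNone (lineBase_finite (F := F) hm hn).toFinset
  let V : Option (F × F) → Set (Fin 3 → F) :=
    fun o => o.elim (Xab m n F) fun q => curve (lineParam q.1 q.2)
  obtain ⟨o, ho, hWo⟩ := IsIrreducibleClosed.exists_subset T (V := V) (W := W) (by
    rintro (_ | q) -
    · exact isIrreducibleClosed_Xab hmn
    · exact isIrreducibleClosed_line _ _) hW (by
    intro P hP
    rcases X_subset (hWX hP) with h | h
    · exact Set.mem_iUnion₂.2 ⟨none, by simp [T], h⟩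
    · obtain ⟨q, hq, hPq⟩ := Set.mem_iUnion₂.1 h
      exact Set.mem_iUnion₂.2 ⟨some q, by simpa [T] using hq, hPq⟩)
  rcases o with _ | q
  · exact Or.inl hWo
  · exact Or.inr ⟨q, by simpa [T] using ho, hWo⟩

lemma isComponent_Xab (hmn : Nat.Coprime m n) (hm : 0 < m) (hn : 0 < n) :
    IsComponent (X m n F) (Xab m n F) := by
  refine ⟨⟨Xab_subset_X, isIrreducibleClosed_Xab hmn⟩, ?_⟩
  rintro W ⟨hWX, hW⟩ hle
  rcases subset_Xab_or_line hmn hm hn hWX hW with h | ⟨q, -, h⟩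
  · exact h
  · exact absurd (hle.trans h) (not_Xab_subset_line hmn hm hn _ _)

lemma IsComponent.eq_Xab_or_line (hmn : Nat.Coprime m n) (hm : 0 < m) (hn : 0 < n)
    {Z : Set (Fin 3 → F)} (hZ : IsComponent (X m n F) Z) :
    Z = Xab m n F ∨ ∃ q ∈ lineBase m n F, Z = curve (lineParam q.1 q.2) := by
  rcases subset_Xab_or_line hmn hm hn hZ.1.1 hZ.1.2 with h | ⟨q, hq, h⟩
  · exact Or.inl (hZ.eq_of_subset ⟨Xab_subset_X, isIrreducibleClosed_Xab hmn⟩ h)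
  · exact Or.inr ⟨q, hq,
      hZ.eq_of_subset ⟨curve_lineParam_subset_X hq, isIrreducibleClosed_line _ _⟩ h⟩

/-- The equations leave t^n ∈ {a, a⁻¹} and t^m ∈ {b, b⁻¹}; replacing t by t⁻¹ identifies the four
cases in pairs. Both remaining points occur because a^m = b^n = b⁻ⁿ. -/
lemma Xab_inter_line (hmn : Nat.Coprime m n) {a b : F} (ha : a ≠ 0) (hb : b ≠ 0)
    (hq : (a + a⁻¹, b + b⁻¹) ∈ lineBase m n F) :
    Xab m n F ∩ curve (lineParam (a + a⁻¹) (b + b⁻¹)) = {diagCoords a b, diagCoords a b⁻¹} := by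
  obtain ⟨h1, h2⟩ := pow_eq_pow_of_mem_lineBase ha hb hq
  rw [Xab_eq_curve hmn]
  ext P
  rw [Set.mem_inter_iff, mem_curve_lineParam, Set.mem_insert_iff, Set.mem_singleton_iff]
  constructor
  · rintro ⟨⟨s, rfl⟩, hx, hy⟩
    obtain ⟨t, ht, rfl⟩ := exists_add_inv_eq s
    replace hx : t ^ n + (t ^ n)⁻¹ = a + a⁻¹ := (congrFun (eval_abParam m n ht) 0).symm.trans hx
    replace hy : t ^ m + (t ^ m)⁻¹ = b + b⁻¹ := (congrFun (eval_abParam m n ht) 1).symm.trans hy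
    have hP : (fun i => (abParam F m n i).eval (t + t⁻¹)) = diagCoords (t ^ n) (t ^ m) :=
      eval_abParam m n ht
    simp only [hP]
    rcases add_inv_eq_add_inv (pow_ne_zero _ ht) ha hx with hx | hx <;>
    rcases add_inv_eq_add_inv (pow_ne_zero _ ht) hb hy with hy | hy <;>
    simp [hx, hy, diagCoords_inv_left]
  · rintro (rfl | rfl)
    · obtain ⟨t, -, -, -, h⟩ := exists_param_diagCoords hmn ha hb h1
      exact ⟨⟨_, h⟩, rfl, rfl⟩
    · obtain ⟨t, -, -, -, h⟩ := exists_param_diagCoords hmn ha (inv_ne_zero hb) h2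
      exact ⟨⟨_, h⟩, rfl, by simp [diagCoords, add_comm]⟩

/-- The curve of abelian characters and a vertical line are both smooth at a common point, and
their tangents agree exactly if the velocity of the former is vertical. -/
lemma tangents_Xab_line (hmn : Nat.Coprime m n) {x y s : F}
    (hP : (fun i => (abParam F m n i).eval s) ∈ curve (lineParam x y)) :
    Module.finrank F (tangentSpace (Xab m n F) fun i => (abParam F m n i).eval s) = 1 ∧
    Module.finrank F
      (tangentSpace (curve (lineParam x y)) fun i => (abParam F m n i).eval s) = 1 ∧
    (tangentSpace (Xab m n F) (fun i => (abParam F m n i).eval s) =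
        tangentSpace (curve (lineParam x y)) (fun i => (abParam F m n i).eval s) ↔
      velocity (abParam F m n) s 0 = 0 ∧ velocity (abParam F m n) s 1 = 0) := by
  have : Infinite F := IsAlgClosed.instInfinite
  obtain ⟨σ, hσ⟩ := exists_aeval_abParam (F := F) hmn
  obtain ⟨r, hr⟩ := hP
  rw [Xab_eq_curve hmn]
  refine ⟨finrank_tangentSpace_curve hσ s, ?_, ?_⟩
  · rw [← hr]
    exact finrank_tangentSpace_curve (aeval_lineParam x y) r
  · rw [tangentSpace_curve hσ, ← hr, tangentSpace_curve (aeval_lineParam x y),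
      velocity_lineParam, span_eq_iff_velocity s (velocity_ne_zero hσ s)]

/-- A vertical velocity would give S_{n-1}(t + t⁻¹) = 0, hence a = t^n = t⁻ⁿ = a⁻¹. -/
lemma isTransverseAt_diagCoords (hmn : Nat.Coprime m n) (hn : (n : F) ≠ 0) {a b x y : F}
    (ha : a ≠ 0) (hb : b ≠ 0) (ha' : a ≠ a⁻¹) (h : a ^ m = b ^ n)
    (hP : diagCoords a b ∈ curve (lineParam x y)) :
    IsTransverseAt (Xab m n F) (curve (lineParam x y)) (diagCoords a b) := by
  obtain ⟨t, ht, hta, -, hPt⟩ := exists_param_diagCoords hmn ha hb h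
  rw [← hPt] at hP ⊢
  obtain ⟨h1, h2, h3⟩ := tangents_Xab_line hmn hP
  refine ⟨Xab_eq_curve (F := F) hmn ▸ ⟨_, rfl⟩, hP, h1, h2, fun he => ?_⟩
  have hv := (h3.1 he).1
  rw [(velocity_abParam _).1, mul_eq_zero, or_iff_right hn] at hv
  have hS := eval_S_add_inv ht n
  rw [hv, zero_mul, hta] at hS
  exact ha' (sub_eq_zero.1 hS.symm)

/-- The first velocity entry dies with n. For the second, S_{m-1}(s)(t - t⁻¹) = b - b⁻¹ = 0, and t ≠
t⁻¹ because t^n = a ≠ a⁻¹. -/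
lemma isTangentAt_diagCoords (hmn : Nat.Coprime m n) (hn : (n : F) = 0) {a b x y : F}
    (ha : a ≠ 0) (hb : b ≠ 0) (ha' : a ≠ a⁻¹) (hb' : b = b⁻¹) (h : a ^ m = b ^ n)
    (hP : diagCoords a b ∈ curve (lineParam x y)) :
    IsTangentAt (Xab m n F) (curve (lineParam x y)) (diagCoords a b) := by
  obtain ⟨t, ht, hta, htb, hPt⟩ := exists_param_diagCoords hmn ha hb h
  rw [← hPt] at hP ⊢
  obtain ⟨h1, h2, h3⟩ := tangents_Xab_line hmn hP
  refine ⟨Xab_eq_curve (F := F) hmn ▸ ⟨_, rfl⟩, hP, h1, h2, h3.2 ?_⟩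
  rw [(velocity_abParam _).1, (velocity_abParam _).2, hn, zero_mul]
  have hS := eval_S_add_inv ht m
  rw [htb, ← hb', sub_self, mul_eq_zero, sub_eq_zero] at hS
  refine ⟨rfl, ?_⟩
  rw [hS.resolve_right fun ht' => ha' ?_, mul_zero]
  rw [← hta, ← inv_pow, ← ht']

end Components

end TorusKnot

theorem mainTheorem7 (m n : ℕ) (hm : 0 < m) (hn : 0 < n) (hmn : Nat.Coprime m n)
    (F : Type*) [Field F] [IsAlgClosed F] (p : ℕ) [CharP F p] :
    TorusKnot.IsComponent (TorusKnot.X m n F) (TorusKnot.Xab m n F) ∧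
    ((p = 0 ∨ Nat.Coprime p (m * n)) →
      ∀ Z : Set (Fin 3 → F), TorusKnot.IsComponent (TorusKnot.X m n F) Z →
        Z ≠ TorusKnot.Xab m n F →
        ∃ P Q : Fin 3 → F, P ≠ Q ∧ TorusKnot.Xab m n F ∩ Z = {P, Q} ∧
          TorusKnot.IsTransverseAt (TorusKnot.Xab m n F) Z P ∧
          TorusKnot.IsTransverseAt (TorusKnot.Xab m n F) Z Q) ∧
    (p.Prime → p ∣ n →
      ∀ Z : Set (Fin 3 → F), TorusKnot.IsComponent (TorusKnot.X m n F) Z →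
        ((∀ P ∈ Z, P 1 = 2) ∨ (∀ P ∈ Z, P 1 = -2)) →
        ∃ P : Fin 3 → F, TorusKnot.Xab m n F ∩ Z = {P} ∧
          TorusKnot.IsTangentAt (TorusKnot.Xab m n F) Z P) := by
  open TorusKnot in
  refine ⟨isComponent_Xab hmn hm hn, fun hp Z hZ hne => ?_, fun hp hpn Z hZ hy => ?_⟩
  · obtain ⟨⟨x, y⟩, hq, rfl⟩ := (hZ.eq_Xab_or_line hmn hm hn).resolve_left hne
    obtain ⟨a, ha, rfl⟩ := exists_add_inv_eq x
    obtain ⟨b, hb, rfl⟩ := exists_add_inv_eq y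
    have hp1 : p ≠ 1 := CharP.char_ne_one F p
    have hmn0 : (m : F) ≠ 0 ∧ (n : F) ≠ 0 := by
      simp only [ne_eq, CharP.cast_eq_zero_iff F p]
      rcases hp with rfl | hp
      · simp [hm.ne', hn.ne']
      · exact ⟨fun h => hp1 (Nat.eq_one_of_dvd_coprimes hp dvd_rfl (h.mul_right n)),
          fun h => hp1 (Nat.eq_one_of_dvd_coprimes hp dvd_rfl (h.mul_left m))⟩
    have ha' := ne_inv_of_S_eq_zero ha hmn0.1 hq.1
    have hb' := ne_inv_of_S_eq_zero hb hmn0.2 hq.2.1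
    obtain ⟨h1, h2⟩ := pow_eq_pow_of_mem_lineBase ha hb hq
    refine ⟨_, _, diagCoords_ne ha' hb', Xab_inter_line hmn ha hb hq,
      isTransverseAt_diagCoords hmn hmn0.2 ha hb ha' h1 ?_,
      isTransverseAt_diagCoords hmn hmn0.2 ha (inv_ne_zero hb) ha' h2 ?_⟩
    · exact mem_curve_lineParam.2 ⟨rfl, rfl⟩
    · exact mem_curve_lineParam.2 ⟨rfl, by simp [diagCoords, add_comm]⟩
  · have hn0 : (n : F) = 0 := (CharP.cast_eq_zero_iff F p n).2 hpn
    have hm0 : (m : F) ≠ 0 := fun h => hp.one_lt.ne'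
      (Nat.eq_one_of_dvd_coprimes hmn ((CharP.cast_eq_zero_iff F p m).1 h) hpn)
    -- The planes y = ±2 correspond to b = ±1, which lets both be treated at once.
    obtain ⟨b, hb, hb', hy⟩ : ∃ b : F, b ≠ 0 ∧ b = b⁻¹ ∧ ∀ P ∈ Z, P 1 = b + b⁻¹ := by
      rcases hy with hy | hy
      · exact ⟨1, one_ne_zero, by simp, fun P hP => by rw [hy P hP]; norm_num⟩
      · exact ⟨-1, by simp, by simp [inv_neg], fun P hP => by rw [hy P hP, inv_neg]; norm_num⟩
    -- The coordinate y takes every value on X^ab, so it is not constant there.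
    have hne : Z ≠ Xab m n F := by
      rintro rfl
      obtain ⟨P, hP, hP1⟩ := (exists_mem_Xab_apply_eq hmn hm hn (b + b⁻¹ + 1)).2
      simp [hy P hP] at hP1
    obtain ⟨⟨x, y⟩, hq, rfl⟩ := (hZ.eq_Xab_or_line hmn hm hn).resolve_left hne
    obtain ⟨a, ha, rfl⟩ := exists_add_inv_eq x
    obtain rfl : y = b + b⁻¹ := hy ![a + a⁻¹, y, 0] (mem_curve_lineParam.2 ⟨rfl, rfl⟩)
    refine ⟨diagCoords a b, ?_, isTangentAt_diagCoords hmn hn0 ha hb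
      (ne_inv_of_S_eq_zero ha hm0 hq.1) hb' (pow_eq_pow_of_mem_lineBase ha hb hq).1
      (mem_curve_lineParam.2 ⟨rfl, rfl⟩)⟩
    rw [Xab_inter_line hmn ha hb hq, ← hb', Set.pair_eq_singleton]
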